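/- Let $\mathcal{A}$ be a small category and let $M\colon \mathcal{A}^{op}\times\mathcal{A}\to\mathsf{Set}$ be a functor (a module). A functor $X\colon\mathcal{A}\to\mathsf{Set}$ is called flat if its category of elements is cofiltered (in particular non-empty); $\mathrm{Flat}(\mathcal{A})$ is the full subcategory of $[\mathcal{A},\mathsf{Set}]$ on the flat functors. Assume that $M$ is flat, i.e. that $M(a,-)$ is flat for every object $a$ of $\mathcal A$. For $m\in M(a,b)$, $f\colon a'\to a$ and $g\colon b\to b'$ write $m@f=M(f,b)(m)\in M(a',b)$ and $g@m=M(a,g)(m)\in M(a,b')$. For a functor $X\colon\mathcal A\to\mathsf{Set}$ let $(M\otimes X)(c)=\int^{b}M(b,c)\times X(b)$, that is, the set of classes $m\otimes x$ of pairs $(m,x)\in M(b,c)\times X(b)$, $b\in\mathcal{A}$, modulo the equivalence relation generated by $(m@f)\otimes x= m\otimes X(f)(x)$. The assignment $X\mapsto M\otimes X$ defines an endofunctor $M\otimes -$ of $\mathrm{Flat}(\mathcal{A})$. An $M$-complex $(a_\bullet,m_\bullet)$ is a sequence of objects $a_0,a_1,a_2,\dots$ of $\mathcal{A}$ together with elements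 $m_{n+1}\in M(a_{n+1},a_n)$, $n\ge 0$. A morphism $(a_\bullet,m_\bullet)\to(a'_\bullet,m'_\bullet)$ is a sequence of morphisms $f_n\colon a_n\to a'_n$ of $\mathcal{A}$ with $f_n@m_{n+1}=m'_{n+1}@f_{n+1}$ for all $n\ge 0$. This gives the category $\mathrm{Complex}(M)$, with the functor $\mathrm{pr}_0\colon\mathrm{Complex}(M)\to\mathcal{A}$, $(a_\bullet,m_\bullet)\mapsto a_0$. Let $$I=\mathrm{colim}\Bigl(\mathrm{Complex}(M)^{op}\xrightarrow{\ \mathrm{pr}_0^{op}\ }\mathcal{A}^{op}\xrightarrow{\ Y\ }[\mathcal{A},\mathsf{Set}]\Bigr),\qquad Y(a)=\mathcal{A}(a,-),$$ and for a complex $(a_\bullet,m_\bullet)$ let $[a_\bullet,m_\bullet]\in I(a_0)$ be the image of $\mathrm{id}_{a_0}$ under the colimit injection $\mathcal{A}(a_0,-)\to I$. Theorem. Suppose that $(\mathcal{A},M)$ satisfies the Strong Solvability Condition: the category $\mathrm{Complex}(M)$ is cofiltered. Then the functor $M\otimes-\colon\mathrm{Flat}(\mathcal{A})\to\mathrm{Flat}(\mathcal{A})$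 has a final coalgebra (a terminal object of the category of coalgebras $X\to M\otimes X$ with $X$ flat). More precisely, the functor $I$ is flat, and there is a natural transformation $\iota\colon I\to M\otimes I$ satisfying $$\iota_{a_0}\bigl([\,\cdots\xrightarrow{m_3}a_2\xrightarrow{m_2}a_1\xrightarrow{m_1}a_0\,]\bigr)=m_1\otimes[\,\cdots\xrightarrow{m_3}a_2\xrightarrow{m_2}a_1\,]$$ for every complex, such that $(I,\iota)$ is a final coalgebra for $M\otimes-$. -/

import Mathlib

open CategoryTheory CategoryTheory.Limits Opposite

universe u

namespace SelfSimilarity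

section Flat

variable (A : Type u) [SmallCategory A]

/-- A functor `X : A ⥤ Set` is flat when its category of elements is cofiltered. -/
def IsFlat : ObjectProperty (A ⥤ Type u) := fun X => IsCofiltered X.Elements

/-- The category `Flat(A)` of flat functors and all natural transformations between them. -/
abbrev Flat : Type (u + 1) := (IsFlat A).FullSubcategory

/-- Modules (profunctors) from `A` to itself, i.e. functors `Aᵒᵖ × A → Set` in curried form:
`M(a, b)` is `(M.obj (op a)).obj b`. -/
abbrev EndoModule : Type (u + 1) := Aᵒᵖ ⥤ A ⥤ Type u

end Flat

variable {A : Type u} [SmallCategory A]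

namespace EndoModule

/-- The set `M(a, b)`. -/
abbrev el (M : EndoModule A) (a b : A) : Type u := (M.obj (op a)).obj b

/-- The action `g @ m` of `g : b ⟶ b'` on `m ∈ M(a, b)`. -/
def lact (M : EndoModule A) {a b b' : A} (g : b ⟶ b') (m : M.el a b) : M.el a b' :=
  (M.obj (op a)).map g m

/-- The action `m @ f` of `f : a' ⟶ a` on `m ∈ M(a, b)`. -/
def ract (M : EndoModule A) {a' a b : A} (m : M.el a b) (f : a' ⟶ a) : M.el a' b :=
  (M.map f.op).app b m

/-- A module is flat when every partial functor `M(a, -)` is flat. -/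
def IsFlatModule (M : EndoModule A) : Prop := ∀ a : A, IsFlat A (M.obj (op a))

section Action

variable (M : EndoModule A)

lemma lact_id {a b : A} (m : M.el a b) : M.lact (𝟙 b) m = m := by simp [lact]

lemma lact_comp {a b b' b'' : A} (g : b ⟶ b') (g' : b' ⟶ b'') (m : M.el a b) :
    M.lact (g ≫ g') m = M.lact g' (M.lact g m) := by simp [lact]

lemma ract_comp {a'' a' a b : A} (f' : a'' ⟶ a') (f : a' ⟶ a) (m : M.el a b) :
    M.ract m (f' ≫ f) = M.ract (M.ract m f) f' := by simp [ract]

lemma lact_ract {a' a b b' : A} (g : b ⟶ b') (m : M.el a b) (f : a' ⟶ a) :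
    M.lact g (M.ract m f) = M.ract (M.lact g m) f := by
  exact ((M.map f.op).naturality_apply g m).symm

end Action

/-! ### The tensor product `M ⊗ X` -/

/-- The relation generating the equivalence whose quotient is the coend
`∫^b M(b, c) × X b`: the pairs `(m @ f, x)` and `(m, X f x)` are related,
for `x ∈ X b`, `f : b ⟶ b'` and `m ∈ M(b', c)`. -/
inductive TensorRel (M : EndoModule A) (X : A ⥤ Type u) (c : A) :
    (Σ b : A, M.el b c × X.obj b) → (Σ b : A, M.el b c × X.obj b) → Prop
  | mk {b b' : A} (f : b ⟶ b') (m : M.el b' c) (x : X.obj b) :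
      TensorRel M X c ⟨b, (M.ract m f, x)⟩ ⟨b', (m, X.map f x)⟩

/-- The set `(M ⊗ X)(c) = ∫^b M(b, c) × X b`. -/
def TensorObj (M : EndoModule A) (X : A ⥤ Type u) (c : A) : Type u :=
  Quot (TensorRel M X c)

/-- The element `m ⊗ x` of `(M ⊗ X)(c)`. -/
def tmk (M : EndoModule A) (X : A ⥤ Type u) {b c : A} (m : M.el b c) (x : X.obj b) :
    TensorObj M X c :=
  Quot.mk _ ⟨b, (m, x)⟩

lemma tmk_ract (M : EndoModule A) (X : A ⥤ Type u) {b b' c : A} (f : b ⟶ b')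
    (m : M.el b' c) (x : X.obj b) :
    tmk M X (M.ract m f) x = tmk M X m (X.map f x) :=
  Quot.sound (.mk f m x)

lemma tmk_surjective (M : EndoModule A) (X : A ⥤ Type u) {c : A} (t : TensorObj M X c) :
    ∃ (b : A) (m : M.el b c) (x : X.obj b), tmk M X m x = t := by
  induction t using Quot.ind with
  | mk p => exact ⟨p.1, p.2.1, p.2.2, rfl⟩

/-- The functor `M ⊗ X : A ⥤ Set`, with `g` sending `m ⊗ x` to `(g @ m) ⊗ x`. -/
def tensor (M : EndoModule A) (X : A ⥤ Type u) : A ⥤ Type u where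
  obj c := TensorObj M X c
  map {c c'} g := TypeCat.ofHom (Quot.lift (fun p => tmk M X (M.lact g p.2.1) p.2.2) (by
    rintro _ _ ⟨f, m, x⟩
    dsimp only
    rw [lact_ract, tmk_ract]))
  map_id c := by
    ext t
    obtain ⟨b, m, x, rfl⟩ := tmk_surjective M X t
    change tmk M X (M.lact (𝟙 c) m) x = tmk M X m x
    rw [lact_id]
  map_comp g g' := by
    ext t
    obtain ⟨b, m, x, rfl⟩ := tmk_surjective M X t
    change tmk M X (M.lact (g ≫ g') m) x = tmk M X (M.lact g' (M.lact g m)) x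
    rw [lact_comp]

lemma tensor_map_tmk (M : EndoModule A) (X : A ⥤ Type u) {b c c' : A} (g : c ⟶ c')
    (m : M.el b c) (x : X.obj b) :
    (M.tensor X).map g (tmk M X m x) = tmk M X (M.lact g m) x := rfl

/-- The natural transformation `M ⊗ h : M ⊗ X ⟶ M ⊗ Y`, sending `m ⊗ x` to `m ⊗ h x`. -/
def tensorMap (M : EndoModule A) {X Y : A ⥤ Type u} (h : X ⟶ Y) : M.tensor X ⟶ M.tensor Y where
  app c := TypeCat.ofHom (Quot.lift (fun p => tmk M Y p.2.1 (h.app p.1 p.2.2)) (by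
    rintro _ _ ⟨f, m, x⟩
    dsimp only
    rw [tmk_ract, NatTrans.naturality_apply]))
  naturality c c' g := by
    ext t
    obtain ⟨b, m, x, rfl⟩ := tmk_surjective M X t
    rfl

/-- The endofunctor `M ⊗ -` of the category of all functors `A ⥤ Set`. -/
def tensorFunctor (M : EndoModule A) : (A ⥤ Type u) ⥤ (A ⥤ Type u) where
  obj X := M.tensor X
  map h := M.tensorMap h
  map_id X := by
    ext c t
    obtain ⟨b, m, x, rfl⟩ := tmk_surjective M X t
    rfl
  map_comp {X Y Z} h k := by
    ext c t
    obtain ⟨b, m, x, rfl⟩ := tmk_surjective M X t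
    rfl

/-! ### Flatness of `M ⊗ X` -/

/-- For flat `X`, equality in the coend is witnessed in one step. -/
lemma exists_of_tmk_eq (M : EndoModule A) {X : A ⥤ Type u} (hX : IsFlat A X) {b b' c : A}
    {m : M.el b c} {x : X.obj b} {m' : M.el b' c} {x' : X.obj b'}
    (h : tmk M X m x = tmk M X m' x') :
    ∃ (d : A) (y : X.obj d) (f : d ⟶ b) (f' : d ⟶ b'),
      X.map f y = x ∧ X.map f' y = x' ∧ M.ract m f = M.ract m' f' := by
  have : IsCofiltered X.Elements := hX
  let R : (Σ b : A, M.el b c × X.obj b) → (Σ b : A, M.el b c × X.obj b) → Prop := fun p q =>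
    ∃ (d : A) (y : X.obj d) (f : d ⟶ p.1) (f' : d ⟶ q.1),
      X.map f y = p.2.2 ∧ X.map f' y = q.2.2 ∧ M.ract p.2.1 f = M.ract q.2.1 f'
  have key : ∀ p q, Relation.EqvGen (TensorRel M X c) p q → R p q := by
    intro p q hpq
    induction hpq with
    | rel p q hr =>
      obtain ⟨f, m, x⟩ := hr
      exact ⟨_, x, 𝟙 _, f, by simp, rfl, by simp [ract]⟩
    | refl p => exact ⟨_, p.2.2, 𝟙 _, 𝟙 _, by simp, by simp, rfl⟩
    | symm p q _ ih =>
      obtain ⟨d, y, f, f', h1, h2, h3⟩ := ih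
      exact ⟨d, y, f', f, h2, h1, h3.symm⟩
    | trans p q r _ _ ih1 ih2 =>
      obtain ⟨d, y, f, f', h1, h2, h3⟩ := ih1
      obtain ⟨e, z, g, g', k1, k2, k3⟩ := ih2
      obtain ⟨⟨w, v⟩, s, t, hst⟩ := IsCofiltered.cospan
        (CategoryOfElements.homMk (X.elementsMk d y) (X.elementsMk q.1 q.2.2) f' h2)
        (CategoryOfElements.homMk (X.elementsMk e z) (X.elementsMk q.1 q.2.2) g k1)
      have hs : X.map s.1 v = y := s.2
      have ht : X.map t.1 v = z := t.2
      have hst' : s.1 ≫ f' = t.1 ≫ g := congrArg Subtype.val hst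
      refine ⟨w, v, s.1 ≫ f, t.1 ≫ g', ?_, ?_, ?_⟩
      · rw [Functor.map_comp_apply, hs, h1]
      · rw [Functor.map_comp_apply, ht, k2]
      · rw [ract_comp, h3, ← ract_comp, hst', ract_comp, k3, ← ract_comp]
  exact key _ _ (Quot.eqvGen_exact h)

/-- Tensoring with a flat module preserves flat functors. -/
theorem isFlat_tensor (M : EndoModule A) (hM : M.IsFlatModule) {X : A ⥤ Type u}
    (hX : IsFlat A X) : IsFlat A (M.tensor X) := by
  have : IsCofiltered X.Elements := hX
  have : ∀ a : A, IsCofiltered (M.obj (op a)).Elements := hM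
  refine { cone_objs := ?_, cone_maps := ?_, nonempty := ?_ }
  · rintro ⟨c, t⟩ ⟨c', t'⟩
    obtain ⟨b, m, x, rfl⟩ := tmk_surjective M X t
    obtain ⟨b', m', x', rfl⟩ := tmk_surjective M X t'
    obtain ⟨⟨d, y⟩, f, f', -⟩ :=
      IsCofilteredOrEmpty.cone_objs (X.elementsMk b x) (X.elementsMk b' x')
    have hf : X.map f.1 y = x := f.2
    have hf' : X.map f'.1 y = x' := f'.2
    obtain ⟨⟨e, n⟩, g, g', -⟩ := IsCofilteredOrEmpty.cone_objs
      ((M.obj (op d)).elementsMk c (M.ract m f.1)) ((M.obj (op d)).elementsMk c' (M.ract m' f'.1))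
    have hg : M.lact g.1 n = M.ract m f.1 := g.2
    have hg' : M.lact g'.1 n = M.ract m' f'.1 := g'.2
    refine ⟨(M.tensor X).elementsMk e (tmk M X n y), CategoryOfElements.homMk _ _ g.1 ?_,
      CategoryOfElements.homMk _ _ g'.1 ?_, trivial⟩
    · change (M.tensor X).map g.1 (tmk M X n y) = tmk M X m x
      rw [tensor_map_tmk, hg, tmk_ract, hf]
    · change (M.tensor X).map g'.1 (tmk M X n y) = tmk M X m' x'
      rw [tensor_map_tmk, hg', tmk_ract, hf']
  · rintro ⟨c, t⟩ ⟨c', t'⟩ u v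
    obtain ⟨b, m, x, rfl⟩ := tmk_surjective M X t
    have hu : tmk M X (M.lact u.1 m) x = t' := u.2
    have hv : tmk M X (M.lact v.1 m) x = t' := v.2
    obtain ⟨d, y, f, f', h1, h2, h3⟩ := exists_of_tmk_eq M hX (hu.trans hv.symm)
    obtain ⟨⟨w, z⟩, s, hs⟩ := IsCofilteredOrEmpty.cone_maps
      (CategoryOfElements.homMk (X.elementsMk d y) (X.elementsMk b x) f h1)
      (CategoryOfElements.homMk (X.elementsMk d y) (X.elementsMk b x) f' h2)
    have hsz : X.map s.1 z = y := s.2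
    have hs' : s.1 ≫ f = s.1 ≫ f' := congrArg Subtype.val hs
    have h4 : M.lact u.1 (M.ract m (s.1 ≫ f)) = M.lact v.1 (M.ract m (s.1 ≫ f)) := by
      rw [lact_ract, lact_ract, ract_comp, h3, ← ract_comp, hs']
    obtain ⟨⟨e, n⟩, g, hg⟩ := IsCofilteredOrEmpty.cone_maps
      (CategoryOfElements.homMk ((M.obj (op w)).elementsMk c (M.ract m (s.1 ≫ f)))
        ((M.obj (op w)).elementsMk c' (M.lact v.1 (M.ract m (s.1 ≫ f)))) u.1 h4)
      (CategoryOfElements.homMk ((M.obj (op w)).elementsMk c (M.ract m (s.1 ≫ f)))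
        ((M.obj (op w)).elementsMk c' (M.lact v.1 (M.ract m (s.1 ≫ f)))) v.1 rfl)
    have hgn : M.lact g.1 n = M.ract m (s.1 ≫ f) := g.2
    have hg' : g.1 ≫ u.1 = g.1 ≫ v.1 := congrArg Subtype.val hg
    refine ⟨(M.tensor X).elementsMk e (tmk M X n z), CategoryOfElements.homMk _ _ g.1 ?_,
      Subtype.ext hg'⟩
    change (M.tensor X).map g.1 (tmk M X n z) = tmk M X m x
    rw [tensor_map_tmk, hgn, tmk_ract, Functor.map_comp_apply, hsz, h1]
  · obtain ⟨⟨b, x⟩⟩ := (IsCofiltered.nonempty : Nonempty X.Elements)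
    obtain ⟨⟨c, m⟩⟩ := (IsCofiltered.nonempty : Nonempty (M.obj (op b)).Elements)
    exact ⟨⟨c, tmk M X m x⟩⟩

/-- The endofunctor `M ⊗ -` of `Flat(A)` given by a flat module `M`. -/
def tensorFlat (M : EndoModule A) (hM : M.IsFlatModule) : Flat A ⥤ Flat A :=
  (IsFlat A).lift ((IsFlat A).ι ⋙ M.tensorFunctor)
    (fun X => M.isFlat_tensor hM X.property)

end EndoModule

/-! ### The category of complexes -/

/-- An `M`-complex `⋯ a₂ -m₂-> a₁ -m₁-> a₀`; here `arr n` is `mₙ₊₁ ∈ M(aₙ₊₁, aₙ)`. -/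
structure Complex (M : EndoModule A) : Type u where
  /-- The objects `aₙ`. -/
  obj : ℕ → A
  /-- The elements `mₙ₊₁`. -/
  arr : ∀ n : ℕ, M.el (obj (n + 1)) (obj n)

namespace Complex

variable {M : EndoModule A}

/-- A morphism of complexes: a sequence `fₙ : aₙ ⟶ a'ₙ` such that all squares commute. -/
@[ext]
structure Hom (p q : Complex M) : Type u where
  /-- The components `fₙ`. -/
  app : ∀ n : ℕ, p.obj n ⟶ q.obj n
  /-- The squares commute: `fₙ @ mₙ₊₁ = m'ₙ₊₁ @ fₙ₊₁`. -/
  comm : ∀ n : ℕ, M.lact (app n) (p.arr n) = M.ract (q.arr n) (app (n + 1))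

instance : Category.{u} (Complex M) where
  Hom := Hom
  id p := ⟨fun n => 𝟙 (p.obj n), fun n => by simp [EndoModule.lact, EndoModule.ract]⟩
  comp f g := ⟨fun n => f.app n ≫ g.app n, fun n => by
    rw [EndoModule.lact_comp, f.comm, EndoModule.lact_ract, g.comm, EndoModule.ract_comp]⟩
  id_comp f := Hom.ext (funext fun n => Category.id_comp (f.app n))
  comp_id f := Hom.ext (funext fun n => Category.comp_id (f.app n))
  assoc f g h := Hom.ext (funext fun n => Category.assoc (f.app n) (g.app n) (h.app n))

/-- The tail `⋯ a₃ -m₃-> a₂ -m₂-> a₁` of a complex. -/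
def tail (p : Complex M) : Complex M := ⟨fun n => p.obj (n + 1), fun n => p.arr (n + 1)⟩

/-- The truncation functor `pr₀`, sending a complex to `a₀`. -/
def pr₀ (M : EndoModule A) : Complex M ⥤ A where
  obj p := p.obj 0
  map f := f.app 0

end Complex

/-- The Strong Solvability Condition: the category of `M`-complexes is cofiltered. -/
def StrongSolvability (M : EndoModule A) : Prop := IsCofiltered (Complex M)

/-- The diagram of representables `Complex(M)ᵒᵖ ⥤ Aᵒᵖ ⥤ [A, Set]`, sending a complex to
`A(a₀, -)`. -/
def reprDiagram (M : EndoModule A) : (Complex M)ᵒᵖ ⥤ (A ⥤ Type u) :=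
  (Complex.pr₀ M).op ⋙ coyoneda

/-- The functor `I : A ⥤ Set`, the colimit of the diagram of representables. -/
noncomputable def carrier (M : EndoModule A) : A ⥤ Type u := colimit (reprDiagram M)

/-- The class `[p] ∈ I(a₀)` of a complex `p`: the image of the identity of `a₀` under the
colimit injection `A(a₀, -) ⟶ I` at `p`. -/
noncomputable def cls {M : EndoModule A} (p : Complex M) : (carrier M).obj (p.obj 0) :=
  (colimit.ι (reprDiagram M) (op p)).app (p.obj 0) (𝟙 (p.obj 0))

end SelfSimilarity

namespace SelfSimilarity

variable {A : Type u} [SmallCategory A] {M : EndoModule A}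

/-! ### The functor `I` -/

/-! An element `x` of a coalgebra `(X, ξ)` unwinds: `ξ x = m₁ ⊗ x₁`, `ξ x₁ = m₂ ⊗ x₂`, and so on.
The choices made form a complex `p` with a resolution of `x` over it, and `x` is sent to `[p]`. The
class does not depend on the choices, because flatness of `X` lets two resolutions be refined
jointly, degree by degree (`exists_next_span`, `map_cls_eq`). The tail of a resolution is a
resolution, so the map respects the coalgebra structures.

For uniqueness, a coalgebra map into `I` carries a resolution over `p` to one over the same `p`, and
in `I` an element resolved over `p` must be `[p]` (`eq_cls`). This applies `map_cls_eq` to `I`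
itself, whose flatness comes from strong solvability. -/

lemma carrier_map_cls (p : Complex M) {a : A} (f : p.obj 0 ⟶ a) :
    (carrier M).map f (cls p) = ((colimit.ι (reprDiagram M) (op p)).app a) f := by
  have h := ((colimit.ι (reprDiagram M) (op p)).naturality_apply f (𝟙 (p.obj 0))).symm
  refine h.trans (congrArg _ ?_)
  exact Category.id_comp f

lemma exists_map_cls_eq {a : A} (x : (carrier M).obj a) :
    ∃ (p : Complex M) (f : p.obj 0 ⟶ a), (carrier M).map f (cls p) = x := by
  obtain ⟨j, f, hf⟩ := Types.jointly_surjective_of_isColimit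
    (isColimitOfPreserves ((evaluation A (Type u)).obj a) (colimit.isColimit (reprDiagram M))) x
  exact ⟨j.unop, f, (carrier_map_cls j.unop f).trans hf⟩

lemma map_app_cls {p q : Complex M} (u : p ⟶ q) :
    (carrier M).map (u.app 0) (cls p) = cls q := by
  rw [carrier_map_cls]
  have h := congrArg (fun t => t.app (q.obj 0) (𝟙 (q.obj 0)))
    (colimit.w (reprDiagram M) u.op)
  refine Eq.trans ?_ h
  exact congrArg ((colimit.ι (reprDiagram M) (op p)).app (q.obj 0))
    (Category.comp_id (u.app 0)).symm

/-- Colimits of functors are pointwise, and this one is filtered by strong solvability, so an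
equality already holds at some stage. -/
lemma exists_hom_of_map_cls_eq (hS : StrongSolvability M) {p q : Complex M} {a : A}
    {f : p.obj 0 ⟶ a} {g : q.obj 0 ⟶ a}
    (h : (carrier M).map f (cls p) = (carrier M).map g (cls q)) :
    ∃ (r : Complex M) (u : r ⟶ p) (v : r ⟶ q), u.app 0 ≫ f = v.app 0 ≫ g := by
  have : IsCofiltered (Complex M) := hS
  rw [carrier_map_cls, carrier_map_cls] at h
  obtain ⟨k, s, t, hst⟩ := (Types.FilteredColimit.isColimit_eq_iff _
    (isColimitOfPreserves ((evaluation A (Type u)).obj a)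
      (colimit.isColimit (reprDiagram M))) (xi := f) (xj := g)).1 h
  exact ⟨k.unop, s.unop, t.unop, hst⟩

/-- Under strong solvability the functor `I` is flat. -/
theorem isFlat_carrier (hS : StrongSolvability M) : IsFlat A (carrier M) := by
  have : IsCofiltered (Complex M) := hS
  refine { cone_objs := ?_, cone_maps := ?_, nonempty := ?_ }
  · rintro ⟨a, x⟩ ⟨b, y⟩
    obtain ⟨p, f, rfl⟩ := exists_map_cls_eq x
    obtain ⟨q, g, rfl⟩ := exists_map_cls_eq y
    obtain ⟨r, u, v, -⟩ := IsCofilteredOrEmpty.cone_objs p q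
    refine ⟨(carrier M).elementsMk (r.obj 0) (cls r),
      CategoryOfElements.homMk _ _ (u.app 0 ≫ f) ?_,
      CategoryOfElements.homMk _ _ (v.app 0 ≫ g) ?_, trivial⟩
    · change (carrier M).map (u.app 0 ≫ f) (cls r) = (carrier M).map f (cls p)
      rw [Functor.map_comp_apply, map_app_cls]
    · change (carrier M).map (v.app 0 ≫ g) (cls r) = (carrier M).map g (cls q)
      rw [Functor.map_comp_apply, map_app_cls]
  · rintro ⟨a, x⟩ ⟨b, y⟩ s t
    obtain ⟨p, f, rfl⟩ := exists_map_cls_eq x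
    have hs : (carrier M).map s.1 ((carrier M).map f (cls p)) = y := s.2
    have ht : (carrier M).map t.1 ((carrier M).map f (cls p)) = y := t.2
    have h := hs.trans ht.symm
    rw [← Functor.map_comp_apply, ← Functor.map_comp_apply] at h
    obtain ⟨r, u, v, huv⟩ := exists_hom_of_map_cls_eq hS h
    -- Both `u` and `v` go from `r` to `p`; once they are equalised, `huv` says that a single arrow
    -- equalises `s` and `t`.
    obtain ⟨r', w, hw⟩ := IsCofilteredOrEmpty.cone_maps u v
    have hw' : w.app 0 ≫ u.app 0 = w.app 0 ≫ v.app 0 := congrArg (fun k => Complex.Hom.app k 0) hw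
    refine ⟨(carrier M).elementsMk (r'.obj 0) (cls r'),
      CategoryOfElements.homMk _ _ ((w ≫ u).app 0 ≫ f) ?_, Subtype.ext ?_⟩
    · change (carrier M).map ((w ≫ u).app 0 ≫ f) (cls r') = (carrier M).map f (cls p)
      rw [Functor.map_comp_apply, map_app_cls]
    · change ((w.app 0 ≫ u.app 0) ≫ f) ≫ s.1 = ((w.app 0 ≫ u.app 0) ≫ f) ≫ t.1
      conv_rhs => rw [hw']
      simpa using congrArg (w.app 0 ≫ ·) huv
  · obtain ⟨p⟩ := (IsCofiltered.nonempty : Nonempty (Complex M))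
    exact ⟨⟨p.obj 0, cls p⟩⟩

/-- The shift of a morphism of complexes. -/
def Complex.tailMap {p q : Complex M} (u : p ⟶ q) : p.tail ⟶ q.tail :=
  (⟨fun n => u.app (n + 1), fun n => u.comm (n + 1)⟩ : Complex.Hom p.tail q.tail)

/-- The natural transformation `I ⟶ M ⊗ I`, sending `[p]` to `p₁ ⊗ [tail p]`. -/
noncomputable def carrierCoaction (M : EndoModule A) : carrier M ⟶ M.tensor (carrier M) :=
  colimit.desc (reprDiagram M)
    { pt := M.tensor (carrier M)
      ι :=
        { app := fun p => coyonedaEquiv.symm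
            (EndoModule.tmk M (carrier M) (p.unop.arr 0) (cls p.unop.tail))
          naturality := fun p q u => by
            ext a (f : p.unop.obj 0 ⟶ a)
            change EndoModule.tmk M (carrier M)
                (M.lact (u.unop.app 0 ≫ f) (q.unop.arr 0)) (cls q.unop.tail) =
              EndoModule.tmk M (carrier M) (M.lact f (p.unop.arr 0)) (cls p.unop.tail)
            -- The square in degree 0 trades `u₀` for `u₁`, which slides across the tensor sign and
            -- is absorbed by the tail.
            rw [EndoModule.lact_comp, u.unop.comm, EndoModule.lact_ract]
            refine (EndoModule.tmk_ract M (carrier M) (u.unop.app 1)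
              (M.lact f (p.unop.arr 0)) (cls q.unop.tail)).trans ?_
            exact congrArg (EndoModule.tmk M (carrier M) (M.lact f (p.unop.arr 0)))
              (map_app_cls (Complex.tailMap u.unop)) } }

lemma carrierCoaction_cls (p : Complex M) :
    (carrierCoaction M).app (p.obj 0) (cls p) =
      EndoModule.tmk M (carrier M) (p.arr 0) (cls p.tail) := by
  have h := congrArg (fun t => t.app (p.obj 0) (𝟙 (p.obj 0)))
    (colimit.ι_desc (F := reprDiagram M) _ (op p) : _ ≫ carrierCoaction M = _)
  refine Eq.trans h ?_
  change EndoModule.tmk M (carrier M) (M.lact (𝟙 _) (p.arr 0)) (cls p.tail) = _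
  rw [EndoModule.lact_id]

/-- The class in `I(pₙ)` of the `n`-fold tail of a complex `p`. -/
noncomputable def tailCls : ∀ (n : ℕ) (p : Complex M), (carrier M).obj (p.obj n)
  | 0, p => cls p
  | n + 1, p => tailCls n p.tail

/-! ### Resolutions -/

/-- A sequence `x` of elements over a complex `p` resolves its first element in the coalgebra
`(X, ξ)` when `ξ xₙ = pₙ₊₁ ⊗ xₙ₊₁` for all `n`. -/
def IsResolution {X : A ⥤ Type u} (ξ : X ⟶ M.tensor X) (p : Complex M)
    (x : ∀ n, X.obj (p.obj n)) : Prop :=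
  ∀ n, ξ.app (p.obj n) (x n) = EndoModule.tmk M X (p.arr n) (x (n + 1))

/-- The classes of its iterated tails resolve the class of a complex. -/
lemma isResolution_tailCls (p : Complex M) :
    IsResolution (carrierCoaction M) p (fun n => tailCls n p) := by
  intro n
  induction n generalizing p with
  | zero => exact carrierCoaction_cls p
  | succ n ih => exact ih p.tail

namespace IsResolution

variable {X : A ⥤ Type u} {ξ : X ⟶ M.tensor X}

lemma tail {p : Complex M} {x : ∀ n, X.obj (p.obj n)} (h : IsResolution ξ p x) :
    IsResolution ξ p.tail (fun n => x (n + 1)) := fun n => h (n + 1)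

lemma map {Y : A ⥤ Type u} {υ : Y ⟶ M.tensor Y} (k : X ⟶ Y) (hk : ξ ≫ M.tensorMap k = k ≫ υ)
    {p : Complex M} {x : ∀ n, X.obj (p.obj n)} (h : IsResolution ξ p x) :
    IsResolution υ p (fun n => k.app _ (x n)) := fun n => by
  have h1 : (M.tensorMap k).app _ (ξ.app _ (x n)) = υ.app _ (k.app _ (x n)) :=
    congrArg (fun t => t.app (p.obj n) (x n)) hk
  rw [← h1, h n]
  rfl

variable (ξ) in
/-- Every element of a coalgebra has a resolution. -/
theorem exists_resolution {a : A} (x : X.obj a) :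
    ∃ (p : Complex M) (y : ∀ n, X.obj (p.obj n)) (h : p.obj 0 = a),
      IsResolution ξ p y ∧ X.map (eqToHom h) (y 0) = x := by
  -- Choosing for all elements at once reduces dependent choice to iteration from `(a, x)`.
  choose b m y hy using fun z : X.Elements => EndoModule.tmk_surjective M X (ξ.app z.1 z.2)
  let s : ℕ → X.Elements := fun n => Nat.rec ⟨a, x⟩ (fun _ z => ⟨b z, y z⟩) n
  exact ⟨⟨fun n => (s n).1, fun n => m (s n)⟩, fun n => (s n).2, rfl,
    fun n => (hy (s n)).symm, X.map_id_apply _ x⟩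

/-- The common refinements, in degree `n`, of two resolutions. -/
structure Span {p q : Complex M} (x : ∀ n, X.obj (p.obj n)) (y : ∀ n, X.obj (q.obj n))
    (n : ℕ) : Type u where
  /-- The apex. -/
  pt : A
  /-- The refining element. -/
  elt : X.obj pt
  /-- The first leg. -/
  fst : pt ⟶ p.obj n
  /-- The second leg. -/
  snd : pt ⟶ q.obj n
  map_fst : X.map fst elt = x n
  map_snd : X.map snd elt = y n

/-- Write `ξ s.elt = m ⊗ z`. Pushing this along each leg gives an equality of tensors, which
flatness witnesses in one step. -/
lemma exists_next_span (hX : IsFlat A X) {p q : Complex M} {x : ∀ n, X.obj (p.obj n)}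
    {y : ∀ n, X.obj (q.obj n)} (hx : IsResolution ξ p x) (hy : IsResolution ξ q y) (n : ℕ)
    (s : Span x y n) :
    ∃ (t : Span x y (n + 1)) (m : M.el t.pt s.pt),
      M.lact s.fst m = M.ract (p.arr n) t.fst ∧ M.lact s.snd m = M.ract (q.arr n) t.snd := by
  have : IsCofiltered X.Elements := hX
  obtain ⟨d, m, z, hz⟩ := EndoModule.tmk_surjective M X (ξ.app s.pt s.elt)
  have h1 : EndoModule.tmk M X (M.lact s.fst m) z = EndoModule.tmk M X (p.arr n) (x (n + 1)) := by
    rw [← hx n, ← s.map_fst, NatTrans.naturality_apply, ← hz]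
    rfl
  have h2 : EndoModule.tmk M X (M.lact s.snd m) z = EndoModule.tmk M X (q.arr n) (y (n + 1)) := by
    rw [← hy n, ← s.map_snd, NatTrans.naturality_apply, ← hz]
    rfl
  obtain ⟨e, w, f, g, hf, hg, hfg⟩ := EndoModule.exists_of_tmk_eq M hX h1
  obtain ⟨e', w', f', g', hf', hg', hfg'⟩ := EndoModule.exists_of_tmk_eq M hX h2
  -- Both witnesses lie over `z`. Merging them there makes one element `m @ (i ≫ f) = m @ (j ≫ f')`
  -- serve both legs.
  obtain ⟨⟨c, v⟩, i, j, hij⟩ := IsCofiltered.cospan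
    (CategoryOfElements.homMk (X.elementsMk e w) (X.elementsMk d z) f hf)
    (CategoryOfElements.homMk (X.elementsMk e' w') (X.elementsMk d z) f' hf')
  have hi : X.map i.1 v = w := i.2
  have hj : X.map j.1 v = w' := j.2
  have h_legs : i.1 ≫ f = j.1 ≫ f' := congrArg Subtype.val hij
  refine ⟨⟨c, v, i.1 ≫ g, j.1 ≫ g', ?_, ?_⟩, M.ract m (i.1 ≫ f), ?_, ?_⟩
  · rw [Functor.map_comp_apply, hi, hg]
  · rw [Functor.map_comp_apply, hj, hg']
  · rw [EndoModule.lact_ract, EndoModule.ract_comp, hfg, ← EndoModule.ract_comp]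
  · rw [h_legs, EndoModule.lact_ract, EndoModule.ract_comp, hfg', ← EndoModule.ract_comp]

/-- The class in `I` of a resolution depends only on the element it resolves. -/
theorem map_cls_eq (hX : IsFlat A X) {p q : Complex M} {x : ∀ n, X.obj (p.obj n)}
    {y : ∀ n, X.obj (q.obj n)} (hx : IsResolution ξ p x) (hy : IsResolution ξ q y) {a : A}
    {f : p.obj 0 ⟶ a} {g : q.obj 0 ⟶ a} (h : X.map f (x 0) = X.map g (y 0)) :
    (carrier M).map f (cls p) = (carrier M).map g (cls q) := by
  have : IsCofiltered X.Elements := hX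
  obtain ⟨⟨d, z⟩, i, j, hij⟩ := IsCofiltered.cospan
    (CategoryOfElements.homMk (X.elementsMk _ (x 0)) (X.elementsMk a (X.map g (y 0))) f h)
    (CategoryOfElements.homMk (X.elementsMk _ (y 0)) (X.elementsMk a (X.map g (y 0))) g rfl)
  have h_legs : i.1 ≫ f = j.1 ≫ g := congrArg Subtype.val hij
  choose t m h1 h2 using exists_next_span hX hx hy
  -- The iterated spans form a complex over both `p` and `q`, whose legs in degree 0 agree after `f`
  -- and `g`.
  let s : ∀ n, Span x y n := fun n => Nat.rec ⟨d, z, i.1, j.1, i.2, j.2⟩ t n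
  let r : Complex M := ⟨fun n => (s n).pt, fun n => m n (s n)⟩
  let u : r ⟶ p := (⟨fun n => (s n).fst, fun n => h1 n (s n)⟩ : Complex.Hom r p)
  let v : r ⟶ q := (⟨fun n => (s n).snd, fun n => h2 n (s n)⟩ : Complex.Hom r q)
  rw [← map_app_cls u, ← map_app_cls v, ← Functor.map_comp_apply, ← Functor.map_comp_apply]
  exact congrArg (fun k => (carrier M).map k (cls r)) h_legs

/-- If `z` resolves its first element over `p` in the coalgebra `I`, that element is `[p]`. -/
theorem eq_cls (hS : StrongSolvability M) {p : Complex M} {z : ∀ n, (carrier M).obj (p.obj n)}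
    (hz : IsResolution (carrierCoaction M) p z) : z 0 = cls p := by
  obtain ⟨q, f, hf⟩ := exists_map_cls_eq (z 0)
  -- Here `z` is compared with the canonical resolution of `[q]` by its tails.
  have h := map_cls_eq (isFlat_carrier hS) hz (isResolution_tailCls q) (f := 𝟙 _) (g := f)
    ((Functor.map_id_apply _ _ _).trans hf.symm)
  rw [← hf, ← h, Functor.map_id_apply]

end IsResolution

/-! ### The final coalgebra -/

/-- The map from a coalgebra `X` to `I`, sending an element to the class of any of its
resolutions. -/
noncomputable def toCarrier {X : A ⥤ Type u} (hX : IsFlat A X) (ξ : X ⟶ M.tensor X) :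
    X ⟶ carrier M where
  app a := TypeCat.ofHom fun x =>
    (carrier M).map (eqToHom (IsResolution.exists_resolution ξ x).choose_spec.choose_spec.choose)
      (cls (IsResolution.exists_resolution ξ x).choose)
  naturality a b f := by
    ext x
    have h1 := (IsResolution.exists_resolution ξ x).choose_spec.choose_spec.choose_spec
    have h2 := (IsResolution.exists_resolution ξ (X.map f x)).choose_spec.choose_spec.choose_spec
    -- The resolution of `x` starts over `a`, not `b`; the arbitrary legs in `map_cls_eq` allow the
    -- comparison.
    refine (h2.1.map_cls_eq hX h1.1 ?_).trans (Functor.map_comp_apply (carrier M) _ f _)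
    rw [h2.2, Functor.map_comp_apply, h1.2]

/-- Frees the map from the resolutions chosen in its definition. -/
lemma toCarrier_app {X : A ⥤ Type u} (hX : IsFlat A X) {ξ : X ⟶ M.tensor X} {p : Complex M}
    {x : ∀ n, X.obj (p.obj n)} (hx : IsResolution ξ p x) :
    (toCarrier hX ξ).app _ (x 0) = cls p := by
  have h1 := (IsResolution.exists_resolution ξ (x 0)).choose_spec.choose_spec.choose_spec
  refine (h1.1.map_cls_eq hX hx (g := 𝟙 _) ?_).trans ((carrier M).map_id_apply _ _)
  rw [h1.2, Functor.map_id_apply]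

lemma toCarrier_comm {X : A ⥤ Type u} (hX : IsFlat A X) (ξ : X ⟶ M.tensor X) :
    ξ ≫ M.tensorMap (toCarrier hX ξ) = toCarrier hX ξ ≫ carrierCoaction M := by
  ext a x
  obtain ⟨p, y, rfl, hy, rfl⟩ := IsResolution.exists_resolution ξ x
  rw [eqToHom_refl, Functor.map_id_apply]
  change (M.tensorMap (toCarrier hX ξ)).app _ (ξ.app _ (y 0)) =
    (carrierCoaction M).app _ ((toCarrier hX ξ).app _ (y 0))
  rw [toCarrier_app hX hy, carrierCoaction_cls, hy 0]
  exact congrArg (EndoModule.tmk M (carrier M) (p.arr 0)) (toCarrier_app hX hy.tail)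

lemma eq_toCarrier (hS : StrongSolvability M) {X : A ⥤ Type u} (hX : IsFlat A X)
    {ξ : X ⟶ M.tensor X} {k : X ⟶ carrier M}
    (hk : ξ ≫ M.tensorMap k = k ≫ carrierCoaction M) : k = toCarrier hX ξ := by
  ext a x
  obtain ⟨p, y, rfl, hy, rfl⟩ := IsResolution.exists_resolution ξ x
  rw [eqToHom_refl, Functor.map_id_apply]
  exact ((hy.map k hk).eq_cls hS).trans (toCarrier_app hX hy).symm

end SelfSimilarity

open SelfSimilarity in
/-- The coalgebra `I` is final. -/
noncomputable def SelfSimilarity.isTerminalCarrier {A : Type u} [SmallCategory A]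
    {M : EndoModule A} (hM : M.IsFlatModule) (hS : StrongSolvability M) :
    IsTerminal (⟨⟨carrier M, isFlat_carrier hS⟩, ObjectProperty.homMk (carrierCoaction M)⟩ :
      Endofunctor.Coalgebra (M.tensorFlat hM)) :=
  IsTerminal.ofUniqueHom
    (fun V =>
      { f := ObjectProperty.homMk (toCarrier V.V.property V.str.hom)
        h := by
          ext : 1
          exact toCarrier_comm V.V.property V.str.hom })
    (fun V k => by
      ext : 2
      exact eq_toCarrier hS V.V.property (congrArg (fun t => t.hom) k.h))

theorem mainTheorem1 (A : Type u) [SmallCategory A] (M : SelfSimilarity.EndoModule A)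
    (hM : M.IsFlatModule) (hS : SelfSimilarity.StrongSolvability M) :
    ∃ (hI : SelfSimilarity.IsFlat A (SelfSimilarity.carrier M))
      (i : SelfSimilarity.carrier M ⟶ M.tensor (SelfSimilarity.carrier M)),
      (∀ p : SelfSimilarity.Complex M,
        i.app (p.obj 0) (SelfSimilarity.cls p) =
          SelfSimilarity.EndoModule.tmk M (SelfSimilarity.carrier M) (p.arr 0)
            (SelfSimilarity.cls p.tail)) ∧
      Nonempty (IsTerminal
        (⟨⟨SelfSimilarity.carrier M, hI⟩, ObjectProperty.homMk i⟩ :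
          Endofunctor.Coalgebra (M.tensorFlat hM))) :=
  ⟨SelfSimilarity.isFlat_carrier hS, SelfSimilarity.carrierCoaction M,
    SelfSimilarity.carrierCoaction_cls, ⟨SelfSimilarity.isTerminalCarrier hM hS⟩⟩
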